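/- Conventions. All vector lattices are real. A *net* in a set is a map from a nonempty directed preordered set. A net $(y_\beta)$ is a *quasi-subnet* of $(x_\alpha)$ if every tail $\{x_\alpha\}_{\alpha\ge\alpha_0}$ contains a tail of $(y_\beta)$. A *convergence structure* on a set $X$ specifies which nets in $X$ converge to which points, so that: constant nets converge to their value; if $x_\alpha\to x$ then every quasi-subnet of $(x_\alpha)$ converges to $x$; if $x_\alpha\to x$, $y_\alpha\to x$ and $z_\alpha\in\{x_\alpha,y_\alpha\}$ for every $\alpha$, then $z_\alpha\to x$. It is *Hausdorff* if every net has at most one limit. The *adherence* of $A\subset X$ is the set of all limits of nets in $A$; $A$ is *closed* if it equals its adherence; the *closure* of $A$ is the intersection of all closed sets containing $A$; $A$ is *topologically dense* if its closure is $X$. A map $\varphi$ is *continuous* if $x_\alpha\to x$ implies $\varphi(x_\alpha)\to\varphi(x)$. A convergence structure on a vector lattice $F$ is *locally solid additive* if addition $F\times F\to F$ and $f\mapsto -f$ are continuous (that is, $e_\alpha\to e$ and $f_\alpha\to f$ imply $e_\alpha+f_\alpha\to e+f$ and $-f_\alpha\to -f$), and $|e_\alpha|\le|f_\alpha|$ for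 all $\alpha$ together with $f_\alpha\to 0$ implies $e_\alpha\to 0$. In a vector lattice, a net $(f_\alpha)$ *converges in order* to $f$ if there is a set $G$ with $\bigwedge G=0$ such that for every $g\in G$ there is $\alpha_0$ with $|f_\alpha-f|\le g$ for all $\alpha\ge\alpha_0$. A linear operator is *order continuous* if it is continuous with respect to the order convergences, and *positive* if it maps positive elements to positive elements. A (linear) sublattice $H\subset F$ is *regular* if every nonempty $G\subset H$ with infimum $0$ in $H$ has infimum $0$ in $F$. A locally solid additive convergence on $F$ is *sturdy* if the adherence of every regular sublattice of $F$ is contained in the closure of that sublattice with respect to the order convergence of $F$. **Corollary 8.6.** Let $F$ be an Archimedean vector lattice (i.e. $\bigwedge_{n\ge1}\frac1n f=0$ for every $f\ge 0$ in $F$) endowed with a sturdy locally solid additive convergence, and let $H\subset F$ be a topologically dense regular sublattice. Let $E$ be a vector lattice endowed with a Hausdorff locally solid additive convergence, and let $T:F\to E$ be a continuous linear operator such that the restriction $T|_H:H\to E$ is positive and order continuous, where $H$ carries its own order convergence. Then $T$ is positive and order continuous on $F$. -/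

import Mathlib

universe u v w

/-- A candidate for a net convergence on `X`: it decides, for every net in `X` indexed by a
nonempty directed preordered set, and every `x : X`, whether the net converges to `x`.
Index sets range over the universe `w`. -/
def NetRel (X : Type u) : Type (max u (w + 1)) :=
  ∀ (ι : Type w) [Preorder ι] [IsDirectedOrder ι] [Nonempty ι], (ι → X) → X → Prop

/-- The net `y` is a quasi-subnet of the net `x`: every tail of `x` contains a tail of `y`. -/
def IsQuasiSubnet {X : Type u} {κ ι : Type w} [Preorder κ] [Preorder ι]
    (y : κ → X) (x : ι → X) : Prop :=
  ∀ a₀ : ι, ∃ b₀ : κ, y '' Set.Ici b₀ ⊆ x '' Set.Ici a₀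

/-- The axioms of a (net) convergence structure. -/
structure NetRel.IsConvergenceStructure {X : Type u} (c : NetRel.{u, w} X) : Prop where
  const : ∀ (ι : Type w) [Preorder ι] [IsDirectedOrder ι] [Nonempty ι] (x : X),
    c ι (fun _ => x) x
  quasiSubnet : ∀ (ι κ : Type w) [Preorder ι] [IsDirectedOrder ι] [Nonempty ι]
    [Preorder κ] [IsDirectedOrder κ] [Nonempty κ] (x : ι → X) (y : κ → X) (l : X),
    IsQuasiSubnet y x → c ι x l → c κ y l
  mix : ∀ (ι : Type w) [Preorder ι] [IsDirectedOrder ι] [Nonempty ι] (x y z : ι → X) (l : X),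
    c ι x l → c ι y l → (∀ a, z a = x a ∨ z a = y a) → c ι z l

/-- Every net has at most one limit. -/
def NetRel.IsHausdorff {X : Type u} (c : NetRel.{u, w} X) : Prop :=
  ∀ (ι : Type w) [Preorder ι] [IsDirectedOrder ι] [Nonempty ι] (x : ι → X) (l m : X),
    c ι x l → c ι x m → l = m

/-- The adherence of `A`: the set of all limits of convergent nets in `A`. -/
def NetRel.adherence {X : Type u} (c : NetRel.{u, w} X) (A : Set X) : Set X :=
  {x | ∃ (ι : Type w) (_ : Preorder ι) (_ : IsDirectedOrder ι) (_ : Nonempty ι) (n : ι → X),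
    (∀ a, n a ∈ A) ∧ c ι n x}

/-- A set is closed if it equals its adherence. -/
def NetRel.IsClosedSet {X : Type u} (c : NetRel.{u, w} X) (A : Set X) : Prop :=
  c.adherence A = A

/-- The closure of `A`: the intersection of all closed sets that contain `A`
(in general larger than the adherence). -/
def NetRel.closure {X : Type u} (c : NetRel.{u, w} X) (A : Set X) : Set X :=
  ⋂₀ {B | c.IsClosedSet B ∧ A ⊆ B}

/-- `A` is topologically dense if its closure is the whole space. -/
def NetRel.TopologicallyDense {X : Type u} (c : NetRel.{u, w} X) (A : Set X) : Prop :=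
  c.closure A = Set.univ

/-- Continuity of a map between spaces with net convergences. -/
def NetContinuous {X : Type u} {Y : Type v} (c : NetRel.{u, w} X) (d : NetRel.{v, w} Y)
    (φ : X → Y) : Prop :=
  ∀ (ι : Type w) [Preorder ι] [IsDirectedOrder ι] [Nonempty ι] (x : ι → X) (l : X),
    c ι x l → d ι (fun a => φ (x a)) (φ l)

/-- A locally solid additive convergence: a convergence structure for which addition and
the additive inverse are continuous, and which is compatible with domination of absolute values. -/
structure NetRel.IsLocallySolidAdditive {F : Type u} [AddCommGroup F] [Lattice F]
    (c : NetRel.{u, w} F) : Prop extends c.IsConvergenceStructure where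
  add : ∀ (ι : Type w) [Preorder ι] [IsDirectedOrder ι] [Nonempty ι] (x y : ι → F) (l m : F),
    c ι x l → c ι y m → c ι (fun a => x a + y a) (l + m)
  neg : ∀ (ι : Type w) [Preorder ι] [IsDirectedOrder ι] [Nonempty ι] (x : ι → F) (l : F),
    c ι x l → c ι (fun a => - x a) (- l)
  solid : ∀ (ι : Type w) [Preorder ι] [IsDirectedOrder ι] [Nonempty ι] (e f : ι → F),
    (∀ a, |e a| ≤ |f a|) → c ι f 0 → c ι e 0

/-- Order convergence: `x` converges to `l` if there is a set `G` with infimum `0` that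
dominates the tails of the net `|x a - l|`. -/
def orderConv (F : Type u) [AddCommGroup F] [Lattice F] : NetRel.{u, w} F :=
  fun ι _ _ _ x l =>
    ∃ G : Set F, IsGLB G 0 ∧ ∀ g ∈ G, ∃ a₀ : ι, ∀ a, a₀ ≤ a → |x a - l| ≤ g

/-- Continuity of a map with respect to the order convergences. -/
def OrderContinuous {F : Type u} {E : Type v} [AddCommGroup F] [Lattice F]
    [AddCommGroup E] [Lattice E] (T : F → E) : Prop :=
  NetContinuous (orderConv.{u, w} F) (orderConv.{v, w} E) T

/-- The Archimedean property of a vector lattice (not to be confused with Mathlib's `Archimedean`,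
which is the notion for linear orders): the multiples `f / n`, `n ≥ 1`, of every positive `f`
have infimum `0`. -/
def IsArchimedeanVL (F : Type u) [AddCommGroup F] [Lattice F] [Module ℝ F] : Prop :=
  ∀ f : F, 0 ≤ f → IsGLB (Set.range fun n : ℕ => (1 / ((n : ℝ) + 1)) • f) 0

/-- A (linear) sublattice of a vector lattice. -/
structure VectorSublattice (F : Type u) [AddCommGroup F] [Lattice F] [Module ℝ F]
    extends Submodule ℝ F where
  sup_mem : ∀ x ∈ toSubmodule, ∀ y ∈ toSubmodule, x ⊔ y ∈ toSubmodule
  inf_mem : ∀ x ∈ toSubmodule, ∀ y ∈ toSubmodule, x ⊓ y ∈ toSubmodule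

/-- A sublattice is a lattice in its own right, with the induced order. -/
instance VectorSublattice.instLattice {F : Type u} [AddCommGroup F] [Lattice F] [Module ℝ F]
    (H : VectorSublattice F) : Lattice H.toSubmodule :=
  Subtype.lattice (fun {x y} hx hy => H.sup_mem x hx y hy)
    (fun {x y} hx hy => H.inf_mem x hx y hy)

/-- A sublattice `H` of `F` is regular if every nonempty `G ⊆ H` whose infimum within `H` is `0`
also has infimum `0` in `F`. -/
def VectorSublattice.IsRegular {F : Type u} [AddCommGroup F] [Lattice F] [Module ℝ F]
    (H : VectorSublattice F) : Prop :=
  ∀ G : Set H.toSubmodule, G.Nonempty → IsGLB G 0 → IsGLB (Subtype.val '' G : Set F) 0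

/-- A locally solid additive convergence is sturdy if the adherence of every regular sublattice
is contained in the closure of that sublattice for the order convergence. -/
structure NetRel.IsSturdy {F : Type u} [AddCommGroup F] [Lattice F] [Module ℝ F]
    (c : NetRel.{u, w} F) : Prop extends c.IsLocallySolidAdditive where
  adherence_subset : ∀ H : VectorSublattice F, H.IsRegular →
    c.adherence (H.toSubmodule : Set F) ⊆
      (orderConv.{u, w} F).closure (H.toSubmodule : Set F)

/-! The key is that `H` approximates from below: every positive `f` in `F` is the supremum of the
elements of `H` in `[0, f]` (`IsSupBelow`). Differences of elements with this property form a
sublattice `supBelowSpan` containing `H`. As `F` is Archimedean and `H` regular, this sublattice is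
regular (`supBelowSpan_isRegular`) and order closed (`isClosedSet_supBelowSpan`); sturdiness then
makes it closed for the given convergence, so by density it is all of `F`.

Density means that the closure, not the adherence, is everything, so facts about `T` spread from `H`
to `F` by showing that they define closed sets (`NetRel.TopologicallyDense.induction`). This gives
positivity, and also that `T f` is the supremum of the values of `T` on the elements of `H` in `[0,
f]` (`map_abs_le_of_topologicallyDense`). With that formula, order continuity on `H` passes to `F`
(`orderContinuous_of_map_le`). -/

section OrderedGroup

variable {F : Type u} [AddCommGroup F] [Lattice F] [IsOrderedAddMonoid F]

theorem le_of_sub_eq_sub {a b c d : F} (h : a ≤ b) (e : d - c = b - a) : c ≤ d :=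
  sub_nonneg.1 (e ▸ sub_nonneg.2 h)

theorem le_of_sub_eq_add {a b a' b' c d : F} (h : a ≤ b) (h' : a' ≤ b')
    (e : d - c = (b - a) + (b' - a')) : c ≤ d :=
  sub_nonneg.1 (e ▸ add_nonneg (sub_nonneg.2 h) (sub_nonneg.2 h'))

theorem inf_add_le_inf_add_right {a b c : F} (hc : 0 ≤ c) : (a + c) ⊓ b ≤ a ⊓ b + c := by
  rw [inf_add]
  exact inf_le_inf_left _ (le_add_of_nonneg_right hc)

theorem le_inf_add_sup_sub (a b : F) : a ≤ a ⊓ b + (a - b) ⊔ 0 := by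
  refine le_of_eq ?_
  rw [← sub_eq_iff_eq_add', sub_inf, sub_self, sup_comm]

end OrderedGroup

theorem IsArchimedeanVL.nonpos_of_nsmul_le {F : Type u} [AddCommGroup F] [Lattice F] [Module ℝ F]
    [IsOrderedModule ℝ F] (hF : IsArchimedeanVL F) {v f : F}
    (h : ∀ n : ℕ, n • v ≤ f) : v ≤ 0 := by
  have hf : 0 ≤ f := by simpa using h 0
  refine (hF f hf).2 ?_
  rintro _ ⟨n, rfl⟩
  have hn : (0 : ℝ) < (n : ℝ) + 1 := by positivity
  have h1 : ((n : ℝ) + 1) • v ≤ f := by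
    have := h (n + 1)
    rwa [← Nat.cast_smul_eq_nsmul ℝ, Nat.cast_succ] at this
  calc v = (1 / ((n : ℝ) + 1)) • (((n : ℝ) + 1) • v) := by
        rw [smul_smul, one_div_mul_cancel hn.ne', one_smul]
    _ ≤ _ := smul_le_smul_of_nonneg_left h1 (by positivity)

/-! ### Elements approximated from below by a regular sublattice. -/

namespace VectorSublattice

variable {F : Type u} [AddCommGroup F] [Lattice F] [Module ℝ F] {H : VectorSublattice F}

/-- In a regular sublattice, a nonempty set of positive elements with no nonzero positive
lower bound in the sublattice has no nonzero positive lower bound in the whole space. -/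
theorem IsRegular.nonpos_of_le (hH : H.IsRegular) {D : Set F} (hD : D ⊆ H.toSubmodule)
    (hne : D.Nonempty) (h0 : ∀ d ∈ D, 0 ≤ d)
    (hD' : ∀ c ∈ H.toSubmodule, 0 ≤ c → (∀ d ∈ D, c ≤ d) → c ≤ 0)
    {x : F} (hx : ∀ d ∈ D, x ≤ d) : x ≤ 0 := by
  obtain ⟨d, hd⟩ := hne
  have key : IsGLB (Subtype.val ⁻¹' D : Set H.toSubmodule) 0 := by
    refine ⟨fun y hy => h0 _ hy, fun c hc => ?_⟩
    have := hD' (c.1 ⊔ 0) (H.sup_mem _ c.2 _ H.toSubmodule.zero_mem) le_sup_right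
      (fun e he => sup_le (hc (a := ⟨e, hD he⟩) he) (h0 e he))
    exact (le_sup_left : c.1 ≤ c.1 ⊔ 0).trans this
  refine (hH _ ⟨⟨d, hD hd⟩, hd⟩ key).2 ?_
  rintro _ ⟨y, hy, rfl⟩
  exact hx _ hy

/-- `f` is positive and the least upper bound of the positive elements of `H` below it. -/
structure IsSupBelow (H : VectorSublattice F) (f : F) : Prop where
  nonneg : 0 ≤ f
  le : ∀ u, (∀ h ∈ H.toSubmodule, 0 ≤ h → h ≤ f → h ≤ u) → f ≤ u

theorem isSupBelow_of_mem {f : F} (hf : f ∈ H.toSubmodule) (h0 : 0 ≤ f) : H.IsSupBelow f :=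
  ⟨h0, fun _ hu => hu f hf h0 le_rfl⟩

namespace IsSupBelow

theorem sup {f g : F} (hf : H.IsSupBelow f) (hg : H.IsSupBelow g) : H.IsSupBelow (f ⊔ g) :=
  ⟨hf.nonneg.trans le_sup_left, fun u hu => sup_le
    (hf.le u fun h hh h0 hhf => hu h hh h0 (hhf.trans le_sup_left))
    (hg.le u fun h hh h0 hhg => hu h hh h0 (hhg.trans le_sup_right))⟩

theorem smul [IsOrderedModule ℝ F] {f : F} (hf : H.IsSupBelow f) {c : ℝ} (hc : 0 ≤ c) :
    H.IsSupBelow (c • f) := by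
  rcases hc.eq_or_lt with rfl | hc
  · rw [zero_smul]
    exact isSupBelow_of_mem H.toSubmodule.zero_mem le_rfl
  · refine ⟨smul_nonneg hc.le hf.nonneg, fun u hu => ?_⟩
    have : f ≤ c⁻¹ • u := by
      refine hf.le _ fun h hh h0 hhf => ?_
      have := smul_le_smul_of_nonneg_left (hu (c • h) (H.toSubmodule.smul_mem _ hh)
        (smul_nonneg hc.le h0) (smul_le_smul_of_nonneg_left hhf hc.le)) (inv_nonneg.2 hc.le)
      rwa [smul_smul, inv_mul_cancel₀ hc.ne', one_smul] at this
    have := smul_le_smul_of_nonneg_left this hc.le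
    rwa [smul_smul, mul_inv_cancel₀ hc.ne', one_smul] at this

theorem trans {L : VectorSublattice F} {f : F} (hf : L.IsSupBelow f)
    (hL : ∀ k ∈ L.toSubmodule, 0 ≤ k → H.IsSupBelow k) : H.IsSupBelow f :=
  ⟨hf.nonneg, fun u hu => hf.le u fun k hk hk0 hkf =>
    (hL k hk hk0).le u fun h hh h0 hhk => hu h hh h0 (hhk.trans hkf)⟩

variable [IsOrderedAddMonoid F]

theorem add {f g : F} (hf : H.IsSupBelow f) (hg : H.IsSupBelow g) : H.IsSupBelow (f + g) := by
  refine ⟨add_nonneg hf.nonneg hg.nonneg, fun u hu => ?_⟩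
  rw [← le_sub_iff_add_le]
  refine hf.le _ fun a ha ha0 haf => ?_
  rw [le_sub_comm]
  refine hg.le _ fun b hb hb0 hbg => ?_
  rw [le_sub_iff_add_le']
  exact hu _ (H.toSubmodule.add_mem ha hb) (add_nonneg ha0 hb0) (add_le_add haf hbg)

/-- The infimum with a fixed element commutes with the supremum that defines `IsSupBelow`. -/
theorem inf_le {f x u : F} (hf : H.IsSupBelow f)
    (hu : ∀ h ∈ H.toSubmodule, 0 ≤ h → h ≤ f → x ⊓ h ≤ u) : x ⊓ f ≤ u := by
  have : f ≤ u + x ⊔ f - x := by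
    refine hf.le _ fun h hh h0 hhf => ?_
    have e := inf_add_sup x h
    have := add_le_add (hu h hh h0 hhf) (sup_le_sup_left hhf x)
    rw [e] at this
    rwa [le_sub_iff_add_le']
  have e := inf_add_sup x f
  rw [le_sub_iff_add_le', ← e] at this
  exact le_of_add_le_add_right this

theorem inf {f g : F} (hf : H.IsSupBelow f) (hg : H.IsSupBelow g) : H.IsSupBelow (f ⊓ g) := by
  refine ⟨le_inf hf.nonneg hg.nonneg, fun u hu => ?_⟩
  refine hg.inf_le fun b hb hb0 hbg => ?_
  rw [inf_comm]
  refine hf.inf_le fun a ha ha0 haf => ?_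
  exact hu _ (H.inf_mem _ hb _ ha) (le_inf hb0 ha0)
    (le_inf (inf_le_right.trans haf) (inf_le_left.trans hbg))

variable [IsOrderedModule ℝ F]

/-- The gaps `h - a - b`, with `a ≤ g` and `b ≤ h - g` positive in `H`, have infimum `0` in `H`: a
positive lower bound `c` can be added to `b` repeatedly, so `n • c ≤ h - g` for all `n`. By
regularity the infimum is `0` in `F`, and `h - g - u` lies below every gap. -/
theorem sub_of_mem (hF : IsArchimedeanVL F) (hH : H.IsRegular) {h g : F}
    (hh : h ∈ H.toSubmodule) (hg : H.IsSupBelow g) (hgh : g ≤ h) : H.IsSupBelow (h - g) := by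
  refine ⟨sub_nonneg.2 hgh, fun u hu => ?_⟩
  let D : Set F := {d | ∃ a ∈ H.toSubmodule, 0 ≤ a ∧ a ≤ g ∧
    ∃ b ∈ H.toSubmodule, 0 ≤ b ∧ b ≤ h - g ∧ d = h - a - b}
  have hle : ∀ a b, a ≤ g → b ≤ h - g → 0 ≤ h - a - b := fun a b ha hb =>
    le_of_sub_eq_add ha hb (by abel)
  rw [← sub_nonpos]
  refine hH.nonpos_of_le (D := D) ?_ ?_ ?_ ?_ ?_
  · rintro _ ⟨a, ha, -, -, b, hb, -, -, rfl⟩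
    exact H.toSubmodule.sub_mem (H.toSubmodule.sub_mem hh ha) hb
  · exact ⟨_, 0, H.toSubmodule.zero_mem, le_rfl, hg.nonneg, 0, H.toSubmodule.zero_mem, le_rfl,
      sub_nonneg.2 hgh, rfl⟩
  · rintro _ ⟨a, -, -, ha, b, -, -, hb, rfl⟩
    exact hle a b ha hb
  · intro c hc hc0 hcD
    have step : ∀ b ∈ H.toSubmodule, 0 ≤ b → b ≤ h - g → b + c ≤ h - g := by
      intro b hb hb0 hbg
      rw [le_sub_comm]
      refine hg.le _ fun a ha ha0 hag => ?_
      exact le_of_sub_eq_sub (hcD _ ⟨a, ha, ha0, hag, b, hb, hb0, hbg, rfl⟩) (by abel)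
    refine hF.nonpos_of_nsmul_le (f := h - g) fun n => ?_
    induction n with
    | zero => rw [zero_smul]; exact sub_nonneg.2 hgh
    | succ n ih =>
      rw [succ_nsmul]
      exact step _ (H.toSubmodule.nsmul_mem hc n) (nsmul_nonneg hc0 n) ih
  · rintro _ ⟨a, ha, ha0, hag, b, hb, hb0, hbg, rfl⟩
    exact le_of_sub_eq_add hag (hu b hb hb0 hbg) (by abel)

theorem sub_sup_zero (hF : IsArchimedeanVL F) (hH : H.IsRegular) {f g : F}
    (hf : H.IsSupBelow f) (hg : H.IsSupBelow g) : H.IsSupBelow ((f - g) ⊔ 0) := by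
  refine ⟨le_sup_right, fun u hu => ?_⟩
  refine sup_le ?_ (hu 0 H.toSubmodule.zero_mem le_rfl le_sup_right)
  rw [sub_le_iff_le_add]
  refine hf.le _ fun a ha ha0 haf => ?_
  -- Replacing `f` by `a ∈ H` reduces the claim to `(a - g) ⊔ 0 = a - a ⊓ g`.
  have h1 := sub_of_mem hF hH ha ((isSupBelow_of_mem ha ha0).inf hg) inf_le_left
  have h2 : a - a ⊓ g ≤ (f - g) ⊔ 0 := by
    rw [sub_inf, sub_self, sup_comm]
    exact sup_le_sup_right (sub_le_sub_right haf g) 0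
  have h3 : a - a ⊓ g ≤ u := h1.le u fun h hh h0 hha => hu h hh h0 (hha.trans h2)
  exact le_of_sub_eq_add h3 (inf_le_right : a ⊓ g ≤ g) (by abel)

end IsSupBelow

/-! ### The sublattice they span: regularity and order closedness. -/

variable [IsOrderedAddMonoid F] [IsOrderedModule ℝ F]

/-- The differences of elements that are suprema of elements of `H` below them. -/
def supBelowSpan (H : VectorSublattice F) : VectorSublattice F where
  carrier := {f | ∃ p q, H.IsSupBelow p ∧ H.IsSupBelow q ∧ f = p - q}
  add_mem' := by
    rintro _ _ ⟨p, q, hp, hq, rfl⟩ ⟨r, s, hr, hs, rfl⟩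
    exact ⟨p + r, q + s, hp.add hr, hq.add hs, by abel⟩
  zero_mem' := ⟨0, 0, isSupBelow_of_mem H.toSubmodule.zero_mem le_rfl,
    isSupBelow_of_mem H.toSubmodule.zero_mem le_rfl, by abel⟩
  smul_mem' := by
    rintro c _ ⟨p, q, hp, hq, rfl⟩
    rcases le_total 0 c with hc | hc
    · exact ⟨c • p, c • q, hp.smul hc, hq.smul hc, smul_sub _ _ _⟩
    · refine ⟨(-c) • q, (-c) • p, hq.smul (neg_nonneg.2 hc), hp.smul (neg_nonneg.2 hc), ?_⟩
      rw [smul_sub, neg_smul, neg_smul]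
      abel
  sup_mem := by
    rintro _ ⟨p, q, hp, hq, rfl⟩ _ ⟨r, s, hr, hs, rfl⟩
    refine ⟨(p + s) ⊔ (r + q), q + s, (hp.add hs).sup (hr.add hq), hq.add hs, ?_⟩
    rw [sup_sub]
    congr 1 <;> abel
  inf_mem := by
    rintro _ ⟨p, q, hp, hq, rfl⟩ _ ⟨r, s, hr, hs, rfl⟩
    refine ⟨(p + s) ⊓ (r + q), q + s, (hp.add hs).inf (hr.add hq), hq.add hs, ?_⟩
    rw [inf_sub]
    congr 1 <;> abel

theorem isSupBelow_of_mem_supBelowSpan (hF : IsArchimedeanVL F) (hH : H.IsRegular) {f : F}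
    (hf : f ∈ H.supBelowSpan.toSubmodule) (h0 : 0 ≤ f) : H.IsSupBelow f := by
  obtain ⟨p, q, hp, hq, rfl⟩ := hf
  rw [← sup_eq_left.2 h0]
  exact hp.sub_sup_zero hF hH hq

theorem subset_supBelowSpan : (H.toSubmodule : Set F) ⊆ H.supBelowSpan.toSubmodule := by
  intro h hh
  refine ⟨h ⊔ 0, (-h) ⊔ 0,
    isSupBelow_of_mem (H.sup_mem _ hh _ H.toSubmodule.zero_mem) le_sup_right,
    isSupBelow_of_mem (H.sup_mem _ (H.toSubmodule.neg_mem hh) _ H.toSubmodule.zero_mem)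
      le_sup_right, ?_⟩
  exact (posPart_sub_negPart h).symm

/-- The reflection `b ↦ h - b` turns approximation of `h - g ⊓ h` from below into approximation of
`g ⊓ h` from above by elements of `H`. -/
theorem le_inf_of_le_upper (hF : IsArchimedeanVL F) (hH : H.IsRegular) {c g h : F}
    (hg : H.IsSupBelow g) (hh : h ∈ H.toSubmodule) (h0 : 0 ≤ h)
    (hc : ∀ d ∈ H.toSubmodule, g ⊓ h ≤ d → c ≤ d) : c ≤ g ⊓ h := by
  have h1 := IsSupBelow.sub_of_mem hF hH hh (hg.inf (isSupBelow_of_mem hh h0)) inf_le_right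
  have h2 : h - g ⊓ h ≤ h - c := h1.le _ fun b hb hb0 hbh => by
    have := hc (h - b) (H.toSubmodule.sub_mem hh hb) (le_sub_comm.1 hbh)
    exact le_sub_comm.1 this
  exact (sub_le_sub_iff_left h).1 h2

/-- After truncation by `h ∈ H`, each `g ∈ G` can be replaced by the elements of `H` above `g ⊓ h`;
these have infimum `0` in `H`, so regularity of `H` applies. -/
theorem supBelowSpan_isRegular (hF : IsArchimedeanVL F) (hH : H.IsRegular) :
    H.supBelowSpan.IsRegular := by
  intro G hG hG0
  obtain ⟨g₀, hg₀⟩ := hG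
  have hP : ∀ g ∈ G, H.IsSupBelow g.1 := fun g hg =>
    isSupBelow_of_mem_supBelowSpan hF hH g.2 (hG0.1 hg)
  refine ⟨?_, fun x hx => ?_⟩
  · rintro _ ⟨g, hg, rfl⟩
    exact hG0.1 hg
  have hxG : ∀ g ∈ G, x ≤ g.1 := fun g hg => hx ⟨g, hg, rfl⟩
  have key : ∀ h ∈ H.toSubmodule, 0 ≤ h → x ⊓ h ≤ 0 := by
    intro h hh h0
    refine hH.nonpos_of_le (D := {d | d ∈ H.toSubmodule ∧ ∃ g ∈ G, g.1 ⊓ h ≤ d})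
      (fun d hd => hd.1) ⟨h, hh, g₀, hg₀, inf_le_right⟩ ?_ ?_ ?_
    · rintro d ⟨-, g, hg, hd⟩
      exact (le_inf (hP g hg).nonneg h0).trans hd
    · intro c hc hc0 hcD
      have hcG : (⟨c, subset_supBelowSpan hc⟩ : H.supBelowSpan.toSubmodule) ∈ lowerBounds G := by
        intro g hg
        exact (le_inf_of_le_upper hF hH (hP g hg) hh h0
          fun d hd hgd => hcD d ⟨hd, g, hg, hgd⟩).trans inf_le_left
      exact hG0.2 hcG
    · rintro d ⟨-, g, hg, hd⟩
      exact (inf_le_inf_right h (hxG g hg)).trans hd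
  have := (hP g₀ hg₀).inf_le (x := x) (u := 0) fun h hh h0 _ => key h hh h0
  rwa [inf_eq_left.2 (hxG g₀ hg₀)] at this

/-- Order limits of positive nets in a regular sublattice are suprema of elements of the
sublattice. -/
theorem isSupBelow_of_orderConv (hF : IsArchimedeanVL F) (hH : H.IsRegular)
    {ι : Type w} [Preorder ι] [IsDirectedOrder ι] [Nonempty ι] {k : ι → F} {f : F}
    (hk : ∀ a, k a ∈ H.toSubmodule) (hk0 : ∀ a, 0 ≤ k a) (hf0 : 0 ≤ f)
    (hkf : orderConv F ι k f) : H.IsSupBelow f := by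
  obtain ⟨G, hG, hGk⟩ := hkf
  refine ⟨hf0, fun u hu => ?_⟩
  have key : ∀ h ∈ H.toSubmodule, 0 ≤ h → f ⊓ h ≤ u := by
    intro h hh h0
    have hm : ∀ a, k a ⊓ h ∈ H.toSubmodule := fun a => H.inf_mem _ (hk a) _ hh
    have hm0 : ∀ a, 0 ≤ k a ⊓ h := fun a => le_inf (hk0 a) h0
    rw [← sub_nonpos]
    refine hG.2 fun g hg => ?_
    obtain ⟨a₀, ha₀⟩ := hGk g hg
    rw [← sub_nonpos]
    have hlow : ∀ a, (∀ δ, a₀ ≤ δ → a ≤ k δ ⊓ h) → a ≤ f := by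
      intro a ha
      rw [← sub_nonpos]
      refine hG.2 fun g' hg' => ?_
      obtain ⟨a₁, ha₁⟩ := hGk g' hg'
      obtain ⟨δ, h0δ, h1δ⟩ := exists_ge_ge a₀ a₁
      have h1 := (le_abs_self _).trans (ha₁ δ h1δ)
      exact le_of_sub_eq_add ((ha δ h0δ).trans inf_le_left) h1 (by abel)
    -- Gaps between the truncated tail and its lower bounds in `H`: if `c` lies below all gaps,
    -- adding `c` to a lower bound of the tail gives another one, so the Archimedean property forces
    -- `c ≤ 0`.
    refine hH.nonpos_of_le (D := {d | ∃ γ, a₀ ≤ γ ∧ ∃ a ∈ H.toSubmodule, 0 ≤ a ∧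
      (∀ δ, a₀ ≤ δ → a ≤ k δ ⊓ h) ∧ d = k γ ⊓ h - a}) ?_ ?_ ?_ ?_ ?_
    · rintro _ ⟨γ, -, a, ha, -, -, rfl⟩
      exact H.toSubmodule.sub_mem (hm γ) ha
    · exact ⟨_, a₀, le_rfl, 0, H.toSubmodule.zero_mem, le_rfl, fun δ _ => hm0 δ, rfl⟩
    · rintro _ ⟨γ, hγ, a, -, -, ha, rfl⟩
      exact sub_nonneg.2 (ha γ hγ)
    · intro c hc hc0 hcD
      have hn : ∀ n : ℕ, ∀ δ, a₀ ≤ δ → n • c ≤ k δ ⊓ h := by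
        intro n
        induction n with
        | zero => intro δ _; rw [zero_smul]; exact hm0 δ
        | succ n ih =>
          intro δ hδ
          rw [succ_nsmul']
          exact le_sub_iff_add_le.1 (hcD _ ⟨δ, hδ, _, H.toSubmodule.nsmul_mem hc n,
            nsmul_nonneg hc0 n, ih, rfl⟩)
      exact hF.nonpos_of_nsmul_le fun n => hn n a₀ le_rfl
    · rintro _ ⟨γ, hγ, a, ha, ha0, haδ, rfl⟩
      have h1 : a ≤ u := hu a ha ha0 (hlow a haδ)
      have h2 : f ⊓ h - k γ ⊓ h ≤ g :=
        (le_abs_self _).trans ((abs_inf_sub_inf_le_abs f (k γ) h).trans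
          (by rw [abs_sub_comm]; exact ha₀ γ hγ))
      exact le_of_sub_eq_add h1 h2 (by abel)
  have hu0 : 0 ≤ u := hu 0 H.toSubmodule.zero_mem le_rfl hf0
  -- The part of `f` not below `u` is disjoint from every positive element of `H`, yet `f` is an
  -- order limit of such elements; hence it vanishes.
  set w := f - f ⊓ u with hw
  have hw0 : 0 ≤ w := sub_nonneg.2 inf_le_left
  have hwh : ∀ h ∈ H.toSubmodule, 0 ≤ h → w ⊓ h ≤ 0 := by
    intro h hh h0
    refine hF.nonpos_of_nsmul_le (f := f) fun n => ?_
    have : n • (w ⊓ h) ≤ f ⊓ (n • h) := by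
      induction n with
      | zero => simpa using hf0
      | succ n ih =>
        have h1 : f ⊓ n • h ≤ f ⊓ u :=
          le_inf inf_le_left (key _ (H.toSubmodule.nsmul_mem hh n) (nsmul_nonneg h0 n))
        rw [succ_nsmul, succ_nsmul]
        refine le_inf ?_ (add_le_add (ih.trans inf_le_right) inf_le_right)
        exact le_of_sub_eq_add (ih.trans h1) (inf_le_left : w ⊓ h ≤ w) (by rw [hw]; abel)
    exact this.trans inf_le_left
  have hw' : w ≤ 0 := by
    refine hG.2 fun g hg => ?_
    obtain ⟨a₀, ha₀⟩ := hGk g hg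
    have hg0 : 0 ≤ g := hG.1 hg
    have h1 : f ≤ k a₀ + g := by
      have := (neg_le_abs _).trans (ha₀ a₀ le_rfl)
      exact le_of_sub_eq_sub this (by abel)
    have h2 : w ≤ (k a₀ + g) ⊓ w :=
      le_inf ((sub_le_self _ (le_inf hf0 hu0)).trans h1) le_rfl
    have h3 := h2.trans (inf_add_le_inf_add_right hg0)
    rw [inf_comm] at h3
    exact h3.trans (add_le_of_nonpos_left (hwh _ (hk a₀) (hk0 a₀)))
  exact (sub_nonpos.1 hw').trans inf_le_right

/-- Positive and negative parts of the limit are limits of positive nets in the span, hence suprema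
of elements of the span, and by `IsSupBelow.trans` of elements of `H`. -/
theorem isClosedSet_supBelowSpan (hF : IsArchimedeanVL F) (hH : H.IsRegular) :
    (orderConv.{u, w} F).IsClosedSet (H.supBelowSpan.toSubmodule : Set F) := by
  apply Set.Subset.antisymm
  · rintro f ⟨ι, _, _, _, k, hk, G, hG, hGk⟩
    have pos : ∀ (k : ι → F) (f : F), (∀ a, k a ∈ H.supBelowSpan.toSubmodule) →
        (∀ g ∈ G, ∃ a₀ : ι, ∀ a, a₀ ≤ a → |k a - f| ≤ g) → H.IsSupBelow (f ⊔ 0) := by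
      intro k f hk hGk
      refine (isSupBelow_of_orderConv (k := fun a => k a ⊔ 0) hF (supBelowSpan_isRegular hF hH)
        (fun a => sup_mem _ _ (hk a) _ (Submodule.zero_mem _)) (fun a => le_sup_right)
        le_sup_right ⟨G, hG, fun g hg => ?_⟩).trans
          fun k hk hk0 => isSupBelow_of_mem_supBelowSpan hF hH hk hk0
      obtain ⟨a₀, ha₀⟩ := hGk g hg
      exact ⟨a₀, fun a ha => (abs_sup_sub_sup_le_abs _ _ _).trans (ha₀ a ha)⟩
    refine ⟨f ⊔ 0, (-f) ⊔ 0, pos k f hk hGk, pos (fun a => -k a) (-f)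
      (fun a => Submodule.neg_mem _ (hk a)) (fun g hg => ?_), (posPart_sub_negPart f).symm⟩
    obtain ⟨a₀, ha₀⟩ := hGk g hg
    refine ⟨a₀, fun a ha => ?_⟩
    rw [neg_sub_neg, abs_sub_comm]
    exact ha₀ a ha
  · intro f hf
    refine ⟨PUnit, inferInstance, inferInstance, inferInstance, fun _ => f, fun _ => hf, {0},
      isGLB_singleton, ?_⟩
    rintro _ rfl
    exact ⟨PUnit.unit, fun _ _ => by simp⟩

/-- A topologically dense regular sublattice is order dense. -/
theorem isSupBelow_of_topologicallyDense (hF : IsArchimedeanVL F) (hH : H.IsRegular)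
    {η : NetRel.{u, w} F} (hη : η.IsSturdy)
    (hd : η.TopologicallyDense (H.toSubmodule : Set F)) {f : F} (hf : 0 ≤ f) :
    H.IsSupBelow f := by
  refine isSupBelow_of_mem_supBelowSpan hF hH ?_ hf
  have hcl : η.IsClosedSet (H.supBelowSpan.toSubmodule : Set F) := by
    apply Set.Subset.antisymm
    -- Sturdiness is applied to the span rather than to `H`: the span is its own order closure.
    · refine (hη.adherence_subset _ (supBelowSpan_isRegular hF hH)).trans ?_
      exact Set.sInter_subset_of_mem ⟨isClosedSet_supBelowSpan hF hH, subset_rfl⟩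
    · intro f hf
      exact ⟨PUnit, inferInstance, inferInstance, inferInstance, fun _ => f, fun _ => hf,
        hη.const _ _⟩
  have : f ∈ η.closure (H.toSubmodule : Set F) := by rw [hd]; trivial
  exact this _ ⟨hcl, subset_supBelowSpan⟩

end VectorSublattice

/-! ### Limits in locally solid convergences and induction over a closure. -/

section LocallySolid

variable {F : Type u} [AddCommGroup F] [Lattice F] {c : NetRel.{u, w} F}

namespace NetRel.IsLocallySolidAdditive

theorem of_abs_sub_le (hc : c.IsLocallySolidAdditive) {ι : Type w} [Preorder ι]
    [IsDirectedOrder ι] [Nonempty ι] {x y : ι → F} {l m : F}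
    (h : ∀ a, |y a - m| ≤ |x a - l|) (hx : c ι x l) : c ι y m := by
  have h1 := hc.add ι _ _ _ _ hx (hc.const ι (-l))
  rw [add_neg_cancel] at h1
  have h2 := hc.solid ι (fun a => y a - m) _ (by simpa only [← sub_eq_add_neg] using h) h1
  simpa using hc.add ι _ _ _ _ h2 (hc.const ι m)

theorem nonneg_of_limit [IsOrderedAddMonoid F] (hc : c.IsLocallySolidAdditive) (hH : c.IsHausdorff)
    {ι : Type w} [Preorder ι] [IsDirectedOrder ι] [Nonempty ι] {x : ι → F} {l : F}
    (h : ∀ a, 0 ≤ x a) (hx : c ι x l) : 0 ≤ l := by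
  -- A positive net converging to `l` also converges to `l ⊔ 0`; limits are unique.
  have h1 : c ι x (l ⊔ 0) := hc.of_abs_sub_le (fun a => by
    simpa only [sup_eq_left.2 (h a)] using abs_sup_sub_sup_le_abs (x a) l 0) hx
  rw [hH ι x _ _ hx h1]
  exact le_sup_right

end NetRel.IsLocallySolidAdditive

end LocallySolid

theorem NetRel.TopologicallyDense.induction {X : Type u} {c : NetRel.{u, w} X}
    (hc : c.IsConvergenceStructure) {A : Set X} (hA : c.TopologicallyDense A) {p : X → Prop}
    (mem : ∀ x ∈ A, p x)
    (limit : ∀ (ι : Type w) [Preorder ι] [IsDirectedOrder ι] [Nonempty ι] (x : ι → X) (l : X),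
      (∀ a, p (x a)) → c ι x l → p l) (x : X) : p x := by
  have hcl : c.IsClosedSet {x | p x} := by
    apply Set.Subset.antisymm
    · rintro l ⟨ι, _, _, _, n, hn, hl⟩
      exact limit ι n l hn hl
    · intro l hl
      exact ⟨PUnit, inferInstance, inferInstance, inferInstance, fun _ => l, fun _ => hl,
        hc.const _ _⟩
  have : x ∈ c.closure A := by rw [hA]; trivial
  exact this _ ⟨hcl, mem⟩

/-! ### Extending positivity and order continuity of `T` from `H` to `F`. -/

section Operator

variable {F : Type u} [AddCommGroup F] [Lattice F] [IsOrderedAddMonoid F]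
  [Module ℝ F]
  {E : Type v} [AddCommGroup E] [Lattice E]
  [Module ℝ E]
  {η : NetRel.{u, w} F} {θ : NetRel.{v, w} E} {H : VectorSublattice F} {T : F →ₗ[ℝ] E}

/-- An order continuous operator on a sublattice maps downward directed sets with infimum `0` in
the sublattice to sets whose lower bounds are all at most `0`. -/
theorem nonpos_of_le_map_of_directed
    (hoc : OrderContinuous.{u, v, max u v} (T ∘ₗ H.toSubmodule.subtype))
    {D : Set F} (hD : D ⊆ H.toSubmodule)
    (hne : D.Nonempty) (h0 : ∀ d ∈ D, 0 ≤ d)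
    (hdir : ∀ a ∈ D, ∀ b ∈ D, ∃ d ∈ D, d ≤ a ∧ d ≤ b)
    (hD' : ∀ c ∈ H.toSubmodule, (∀ d ∈ D, c ≤ d) → c ≤ 0)
    {e : E} (he : ∀ d ∈ D, e ≤ T d) : e ≤ 0 := by
  -- `D` with reversed order indexes itself as a net decreasing to `0` in `H`.
  let ι := ULift.{max u v} Dᵒᵈ
  let val : ι → F := fun i => (OrderDual.ofDual i.down).1
  have hval : ∀ i, val i ∈ D := fun i => (OrderDual.ofDual i.down).2
  have hle : ∀ i j : ι, i ≤ j → val j ≤ val i := fun i j h => h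
  have : Nonempty ι := let ⟨d, hd⟩ := hne; ⟨⟨OrderDual.toDual ⟨d, hd⟩⟩⟩
  have : IsDirectedOrder ι := ⟨fun i j => by
    obtain ⟨d, hd, h1, h2⟩ := hdir _ (hval i) _ (hval j)
    exact ⟨⟨OrderDual.toDual ⟨d, hd⟩⟩, h1, h2⟩⟩
  obtain ⟨G, hG, hGT⟩ := hoc ι (fun i => ⟨val i, hD (hval i)⟩) 0 <| by
    refine ⟨Subtype.val ⁻¹' D, ⟨fun d hd => h0 _ hd, fun c hc => ?_⟩, fun g hg => ?_⟩
    · exact hD' c.1 c.2 fun d hd => hc (a := ⟨d, hD hd⟩) hd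
    · let i₀ : ι := ULift.up (OrderDual.toDual (⟨g.1, hg⟩ : D))
      refine ⟨i₀, fun i hi => ?_⟩
      have h1 : val i ≤ g.1 := hle i₀ i hi
      have h2 : 0 ≤ val i := h0 _ (hval i)
      rw [sub_zero]
      refine sup_le (show val i ≤ g.1 from h1) (show -val i ≤ g.1 from ?_)
      exact (neg_nonpos.2 h2).trans (h2.trans h1)
  refine hG.2 fun g hg => ?_
  obtain ⟨i, hi⟩ := hGT g hg
  have := (le_abs_self _).trans (hi i le_rfl)
  rw [map_zero, sub_zero] at this
  exact (he _ (hval i)).trans this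

variable [IsOrderedAddMonoid E]

theorem map_nonneg_of_topologicallyDense (hη : η.IsLocallySolidAdditive)
    (hθ : θ.IsLocallySolidAdditive) (hθH : θ.IsHausdorff)
    (hdense : η.TopologicallyDense (H.toSubmodule : Set F)) (hT : NetContinuous η θ T)
    (hpos : ∀ h ∈ H.toSubmodule, 0 ≤ h → 0 ≤ T h) {f : F} (hf : 0 ≤ f) : 0 ≤ T f := by
  rw [← sup_eq_left.2 hf]
  refine hdense.induction hη.toIsConvergenceStructure (p := fun f => 0 ≤ T (f ⊔ 0))
    (fun h hh => hpos _ (H.sup_mem _ hh _ H.toSubmodule.zero_mem) le_sup_right) ?_ f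
  intro ι _ _ _ x l hx hl
  refine hθ.nonneg_of_limit hθH hx (hT ι (fun a => x a ⊔ 0) (l ⊔ 0) ?_)
  exact hη.of_abs_sub_le (fun a => abs_sup_sub_sup_le_abs _ _ _) hl

theorem LinearMap.mono_of_nonneg (hT : ∀ f : F, 0 ≤ f → 0 ≤ T f) {f g : F} (h : f ≤ g) :
    T f ≤ T g := by
  have := hT (g - f) (sub_nonneg.2 h)
  rwa [map_sub, sub_nonneg] at this

/-- Between `0` and an element of an order dense sublattice, the values of `T` are determined by
those on the sublattice. -/
theorem map_le_of_le_of_mem (hsup : ∀ f : F, 0 ≤ f → H.IsSupBelow f)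
    (hT : ∀ f : F, 0 ≤ f → 0 ≤ T f)
    (hoc : OrderContinuous.{u, v, max u v} (T ∘ₗ H.toSubmodule.subtype))
    {f h : F} (hf : 0 ≤ f) (hh : h ∈ H.toSubmodule) (hfh : f ≤ h) {e : E}
    (he : ∀ a ∈ H.toSubmodule, 0 ≤ a → a ≤ f → T a ≤ e) : T f ≤ e := by
  rw [← sub_nonpos]
  -- `f` is squeezed between elements `a ≤ f ≤ b` of `H`. The majorant `h` provides such `b`, and
  -- makes `f` the infimum of them because `h - f` is approximated from below.
  refine nonpos_of_le_map_of_directed hoc (D := {d | ∃ a ∈ H.toSubmodule, 0 ≤ a ∧ a ≤ f ∧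
    ∃ b ∈ H.toSubmodule, f ≤ b ∧ d = b - a}) ?_ ?_ ?_ ?_ ?_ ?_
  · rintro _ ⟨a, ha, -, -, b, hb, -, rfl⟩
    exact H.toSubmodule.sub_mem hb ha
  · exact ⟨_, 0, H.toSubmodule.zero_mem, le_rfl, hf, h, hh, hfh, rfl⟩
  · rintro _ ⟨a, -, -, ha, b, -, hb, rfl⟩
    exact sub_nonneg.2 (ha.trans hb)
  · rintro _ ⟨a, ha, ha0, haf, b, hb, hfb, rfl⟩ _ ⟨a', ha', -, haf', b', hb', hfb', rfl⟩
    exact ⟨_, ⟨a ⊔ a', H.sup_mem _ ha _ ha', ha0.trans le_sup_left, sup_le haf haf', b ⊓ b',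
      H.inf_mem _ hb _ hb', le_inf hfb hfb', rfl⟩, sub_le_sub inf_le_left le_sup_left,
      sub_le_sub inf_le_right le_sup_right⟩
  · intro c hc hcD
    have h1 : ∀ b ∈ H.toSubmodule, f ≤ b → c ≤ b - f := by
      intro b hb hfb
      rw [le_sub_comm]
      refine (hsup f hf).le _ fun a ha ha0 haf => ?_
      exact le_sub_comm.1 (hcD _ ⟨a, ha, ha0, haf, b, hb, hfb, rfl⟩)
    have h2 : h - f ≤ h - f - c := by
      refine (hsup _ (sub_nonneg.2 hfh)).le _ fun b hb hb0 hbf => ?_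
      exact le_of_sub_eq_sub (h1 (h - b) (H.toSubmodule.sub_mem hh hb) (le_sub_comm.1 hbf))
        (by abel)
    simpa using h2
  · rintro _ ⟨a, ha, ha0, haf, b, hb, hfb, rfl⟩
    rw [map_sub]
    exact sub_le_sub (LinearMap.mono_of_nonneg hT hfb) (he a ha ha0 haf)

/-- Stated through `|f|` so that it makes sense on all of `F` and defines a closed set. For `h ≤ |x
a|` in `H`, split `h ≤ h ⊓ |l| + (h - |l|) ⊔ 0`: the first term has a majorant in `H`, so
`map_le_of_le_of_mem` applies, and the second is at most `|x a - l|`, whose image tends to `0`. -/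
theorem map_abs_le_of_topologicallyDense {θ : NetRel.{v, max u v} E}
    {η : NetRel.{u, max u v} F} (hη : η.IsLocallySolidAdditive)
    (hθ : θ.IsLocallySolidAdditive) (hθH : θ.IsHausdorff)
    (hdense : η.TopologicallyDense (H.toSubmodule : Set F)) (hTc : NetContinuous η θ T)
    (hsup : ∀ f : F, 0 ≤ f → H.IsSupBelow f) (hT : ∀ f : F, 0 ≤ f → 0 ≤ T f)
    (hoc : OrderContinuous.{u, v, max u v} (T ∘ₗ H.toSubmodule.subtype)) (f : F) :
    ∀ e : E, (∀ a ∈ H.toSubmodule, 0 ≤ a → a ≤ |f| → T a ≤ e) → T |f| ≤ e := by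
  refine hdense.induction hη.toIsConvergenceStructure
    (p := fun f => ∀ e : E, (∀ a ∈ H.toSubmodule, 0 ≤ a → a ≤ |f| → T a ≤ e) → T |f| ≤ e)
    (fun h hh e he => he _ (H.sup_mem _ hh _ (H.toSubmodule.neg_mem hh)) (abs_nonneg h) le_rfl)
    ?_ f
  intro ι _ _ _ x l hx hl e he
  have h1 : ∀ a, T |x a| ≤ e + T |x a - l| := by
    intro a
    refine hx a _ fun h hh h0 hhx => ?_
    have h2 : T (h ⊓ |l|) ≤ e := map_le_of_le_of_mem hsup hT hoc
      (le_inf h0 (abs_nonneg l)) hh inf_le_left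
      fun b hb hb0 hbl => he b hb hb0 (hbl.trans inf_le_right)
    have h3 : (h - |l|) ⊔ 0 ≤ |x a - l| := sup_le
      ((sub_le_sub_right hhx _).trans ((le_abs_self _).trans (abs_abs_sub_abs_le _ _)))
      (abs_nonneg _)
    refine (LinearMap.mono_of_nonneg hT (le_inf_add_sup_sub h |l|)).trans ?_
    rw [map_add]
    exact add_le_add h2 (LinearMap.mono_of_nonneg hT h3)
  have hd : η ι (fun a => |x a - l|) 0 := hη.of_abs_sub_le (fun a => by simp) hl
  have habs : η ι (fun a => |x a|) |l| :=
    hη.of_abs_sub_le (fun a => abs_abs_sub_abs_le _ _) hl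
  have h4 : θ ι (fun a => e + T |x a - l| + -T |x a|) (e + 0 + -T |l|) := by
    refine hθ.add ι _ _ _ _ (hθ.add ι _ _ _ _ (hθ.const ι e) ?_) (hθ.neg ι _ _ (hTc ι _ _ habs))
    simpa using hTc ι _ _ hd
  have h5 := hθ.nonneg_of_limit hθH (fun a => by
    rw [← sub_eq_add_neg, sub_nonneg]; exact h1 a) h4
  rwa [add_zero, ← sub_eq_add_neg, sub_nonneg] at h5

variable [IsOrderedModule ℝ F]

/-- A positive operator that is determined from below by its order continuous restriction to an
order dense regular sublattice is itself order continuous. -/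
theorem orderContinuous_of_map_le (hF : IsArchimedeanVL F) (hH : H.IsRegular)
    (hsup : ∀ f : F, 0 ≤ f → H.IsSupBelow f) (hT : ∀ f : F, 0 ≤ f → 0 ≤ T f)
    (hoc : OrderContinuous.{u, v, max u v} (T ∘ₗ H.toSubmodule.subtype))
    (hTsup : ∀ f : F, 0 ≤ f →
      ∀ e : E, (∀ a ∈ H.toSubmodule, 0 ≤ a → a ≤ f → T a ≤ e) → T f ≤ e) :
    OrderContinuous.{u, v, w} T := by
  intro ι _ _ _ x l ⟨G, hG, hGx⟩
  -- All eventual bounds, rather than only `G`, so that the set is closed under finite infima.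
  let Y : Set F := {y | ∃ a₀ : ι, ∀ a, a₀ ≤ a → |x a - l| ≤ y}
  have hY0 : ∀ y ∈ Y, 0 ≤ y := fun y ⟨a₀, ha₀⟩ => (abs_nonneg _).trans (ha₀ a₀ le_rfl)
  have hYinf : ∀ y ∈ Y, ∀ z ∈ Y, y ⊓ z ∈ Y := by
    rintro y ⟨a, ha⟩ z ⟨b, hb⟩
    obtain ⟨c, hac, hbc⟩ := exists_ge_ge a b
    exact ⟨c, fun d hd => le_inf (ha d (hac.trans hd)) (hb d (hbc.trans hd))⟩
  have hYlow : ∀ c, (∀ y ∈ Y, c ≤ y) → c ≤ 0 := fun c hc => hG.2 fun g hg => hc g (hGx g hg)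
  obtain ⟨y₀, hy₀⟩ : Y.Nonempty := by
    rcases G.eq_empty_or_nonempty with rfl | ⟨g, hg⟩
    · obtain ⟨a⟩ := ‹Nonempty ι›
      -- If `G` is empty, `0` is the greatest element of `F`, so it bounds the net.
      exact ⟨0, a, fun b _ => hG.2 (by simp)⟩
    · exact ⟨g, hGx g hg⟩
  refine ⟨T '' Y, ⟨?_, fun e he => ?_⟩, ?_⟩
  · rintro _ ⟨y, hy, rfl⟩
    exact hT y (hY0 y hy)
  · have he' : ∀ y ∈ Y, e ≤ T y := fun y hy => he ⟨y, hy, rfl⟩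
    -- By the supremum formula it suffices that `e ≤ T (y₀ - h)` for positive `h ≤ y₀` in `H`. The
    -- elements of `H` above some `y ⊓ h` decrease to `0`, and `y ⊓ y₀` exceeds such an element by
    -- at most `y₀ - h`.
    have h1 : T y₀ ≤ T y₀ - e := by
      refine hTsup y₀ (hY0 _ hy₀) _ fun h hh h0 hhy => ?_
      rw [le_sub_comm, ← sub_nonpos]
      refine nonpos_of_le_map_of_directed hoc
        (D := {d | d ∈ H.toSubmodule ∧ ∃ y ∈ Y, y ⊓ h ≤ d}) (fun d hd => hd.1)
        ⟨h, hh, y₀, hy₀, inf_le_right⟩ ?_ ?_ ?_ ?_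
      · rintro d ⟨-, y, hy, hd⟩
        exact (le_inf (hY0 y hy) h0).trans hd
      · rintro d ⟨hdH, y, hy, hd⟩ d' ⟨hdH', y', hy', hd'⟩
        exact ⟨d ⊓ d', ⟨H.inf_mem _ hdH _ hdH', y ⊓ y', hYinf _ hy _ hy',
          le_inf ((inf_le_inf_right h inf_le_left).trans hd)
            ((inf_le_inf_right h inf_le_right).trans hd')⟩, inf_le_left, inf_le_right⟩
      · intro c hc hcD
        refine hYlow c fun y hy => ?_
        exact (VectorSublattice.le_inf_of_le_upper hF hH (hsup y (hY0 y hy)) hh h0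
          fun d hd hyd => hcD d ⟨hd, y, hy, hyd⟩).trans inf_le_left
      · rintro d ⟨-, y, hy, hd⟩
        have h2 : y ⊓ y₀ ≤ d + (y₀ - h) := by
          refine (le_inf_add_sup_sub (y ⊓ y₀) h).trans (add_le_add ?_ ?_)
          · exact (inf_le_inf_right h inf_le_left).trans hd
          · exact sup_le (sub_le_sub_right inf_le_right h) (sub_nonneg.2 hhy)
        have h3 := (he' _ (hYinf _ hy _ hy₀)).trans (LinearMap.mono_of_nonneg hT h2)
        rwa [map_add, map_sub, ← sub_le_iff_le_add] at h3
    simpa using h1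
  · rintro _ ⟨y, ⟨a₀, ha₀⟩, rfl⟩
    refine ⟨a₀, fun a ha => ?_⟩
    rw [← map_sub]
    refine abs_le'.2 ⟨LinearMap.mono_of_nonneg hT ((le_abs_self _).trans (ha₀ a ha)), ?_⟩
    rw [← map_neg]
    exact LinearMap.mono_of_nonneg hT ((neg_le_abs _).trans (ha₀ a ha))

end Operator

theorem corollary8p6
    {F : Type u} [AddCommGroup F] [Lattice F] [IsOrderedAddMonoid F]
    [Module ℝ F] [IsOrderedModule ℝ F] (hF : IsArchimedeanVL F)
    {E : Type v} [AddCommGroup E] [Lattice E] [IsOrderedAddMonoid E]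
    [Module ℝ E] [IsOrderedModule ℝ E]
    (η : NetRel.{u, max u v} F) (hη : η.IsSturdy)
    (θ : NetRel.{v, max u v} E) (hθ : θ.IsLocallySolidAdditive) (hθH : θ.IsHausdorff)
    (H : VectorSublattice F) (hreg : H.IsRegular)
    (hdense : η.TopologicallyDense (H.toSubmodule : Set F))
    (T : F →ₗ[ℝ] E) (hT : NetContinuous η θ T)
    (hpos : ∀ h : H.toSubmodule, 0 ≤ h → 0 ≤ T h)
    (hoc : OrderContinuous.{u, v, max u v} (T ∘ₗ H.toSubmodule.subtype)) :
    (∀ f : F, 0 ≤ f → 0 ≤ T f) ∧ OrderContinuous.{u, v, max u v} T := by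
  have hη' := hη.toIsLocallySolidAdditive
  have hT0 : ∀ f : F, 0 ≤ f → 0 ≤ T f := fun f hf =>
    map_nonneg_of_topologicallyDense hη' hθ hθH hdense hT
      (fun h hh h0 => hpos ⟨h, hh⟩ h0) hf
  have hsup : ∀ f : F, 0 ≤ f → H.IsSupBelow f := fun f hf =>
    VectorSublattice.isSupBelow_of_topologicallyDense hF hreg hη hdense hf
  refine ⟨hT0, orderContinuous_of_map_le hF hreg hsup hT0 hoc fun f hf => ?_⟩
  have := map_abs_le_of_topologicallyDense hη' hθ hθH hdense hT hsup hT0 hoc f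
  rwa [abs_of_nonneg hf] at this
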